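/- Let $L\ge 1$, $p\ge 0$, $E\ge 0$, and let $D=D_0-2\epsilon$ with $D_0\in\mathbb{N}$. Consider the family of $L$-loop Feynman integrals $$I(x;\nu;D)=\int\Big(\prod_{a=1}^{L}e^{\gamma_E\epsilon}\frac{\mathrm{d}^Dk_a}{i\pi^{D/2}}\Big)\frac{\mathcal{N}(\{k_a\cdot k_b,\,k_a\cdot p_l\};D)}{\prod_{j=1}^{p}(m_j^2-q_j^2-i0)^{\nu_j}},\qquad q_j=\sum_{a=1}^{L}\alpha_{ja}k_a+\sum_{l=1}^{E-1}\beta_{jl}p_l,\quad \alpha_{ja},\beta_{jl}\in\{-1,0,1\},$$ with $\nu\in\mathbb{Z}^p$, real masses $m_j$, real dot products $p_l\cdot p_{l'}$ ($1\le l,l'\le E-1$) of the independent external momenta, $x=(\{p_l\cdot p_{l'}\},\{m_j^2\})$, and a numerator $\mathcal{N}$ that is a polynomial in the dot products involving at least one loop momentum, with coefficients that may depend on $D$. The integral is understood in dimensional regularisation, as follows. For $\eta,\delta>0$ let $I_{\eta,\delta}(\nu;D)$ be the integral with $-i0$ replaced by $-i\eta$ and with the additional factor $e^{i\delta\sum_a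 k_a^2}$ in the integrand; it is defined by writing every factor with $\nu_j>0$ as $$\frac{1}{(m_j^2-q_j^2-i\eta)^{\nu_j}}=\frac{i^{\nu_j}}{\Gamma(\nu_j)}\int_0^\infty\alpha_j^{\nu_j-1}e^{-i\alpha_j(m_j^2-q_j^2-i\eta)}\,\mathrm{d}\alpha_j ,$$ regarding all other factors as polynomials in the dot products, and performing the integral over the loop momenta first, by the $D$-dimensional Gaussian formula: for a positive definite matrix $A$, $\int\prod_a\frac{\mathrm{d}^Dk_a}{i\pi^{D/2}}\,e^{i\sum_{a,b}A_{ab}k_a\cdot k_b}=e^{-i\pi LD/4}(\det A)^{-D/2}$, with polynomials in the dot products averaged with the Gaussian (Wick) moments $\langle k_a^\mu k_b^\nu\rangle=\tfrac{i}{2}(A^{-1})_{ab}g^{\mu\nu}$, $g^\mu{}_\mu=D$, and linear terms in the exponent removed by completing the square. Let $I_\eta(\nu;D)$ be the meromorphic function of $D\in\mathbb{C}$ that equals $\lim_{\delta\to0^+}I_{\eta,\delta}(\nu;D)$ when $\operatorname{Re}D$ is sufficiently negative, and let $I(x;\nu;D)$ be the meromorphic function of $D\in\mathbb{C}$ that equals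 $\lim_{\eta\to0^+}I_\eta(\nu;D)$ when $\operatorname{Re}D$ is sufficiently large (in both cases up to a closed discrete set of values of $D$, with removable singularities removed). If $\nu_j\le 0$ for all $1\le j\le p$, then the dimensionally regularised integral $I(x;\nu;D)$ exists, is unique, and vanishes: $I(x;\nu;D)=0$ for every $D\in\mathbb{C}$. -/

import Mathlib

open Filter Topology MeasureTheory

noncomputable section

namespace FeynmanIntegral

/-! ### Momenta and dot products

There are `L` loop momenta `k_a` and `n` independent external momenta `p_l`.  The number of
components of a momentum is a complex parameter `D`, so momenta enter only through their dot
products; the dot products of external momenta form a real symmetric matrix `G`. -/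

/-- Names of the momenta: `Sum.inl a` is `k_a`, `Sum.inr l` is `p_l`. -/
abbrev Momentum (L n : ℕ) := Fin L ⊕ Fin n

/-- Names of the dot products that involve a loop momentum: `Sum.inl s(a, b)` is `k_a · k_b`,
`Sum.inr (a, l)` is `k_a · p_l`. -/
abbrev DotProduct (L n : ℕ) := Sym2 (Fin L) ⊕ (Fin L × Fin n)

/-- Polynomials in the dot products that involve a loop momentum. -/
abbrev DotPoly (L n : ℕ) := MvPolynomial (DotProduct L n) ℂ

variable {L n p : ℕ}

/-- The dot product of two momenta. -/
def dot (G : Matrix (Fin n) (Fin n) ℝ) : Momentum L n → Momentum L n → DotPoly L n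
  | Sum.inl a, Sum.inl b => MvPolynomial.X (Sum.inl s(a, b))
  | Sum.inl a, Sum.inr l => MvPolynomial.X (Sum.inr (a, l))
  | Sum.inr l, Sum.inl a => MvPolynomial.X (Sum.inr (a, l))
  | Sum.inr l, Sum.inr l' => MvPolynomial.C ((G l l' : ℝ) : ℂ)

/-- Chain rule: `∂f/∂k_{a,μ} = ∑_w (gradCoeff a w f) w^μ`, the sum being over all momenta `w`. -/
def gradCoeff (a : Fin L) (w : Momentum L n) (f : DotPoly L n) : DotPoly L n :=
  match w with
  | Sum.inl b => (if a = b then 2 else 1) * MvPolynomial.pderiv (Sum.inl s(a, b)) f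
  | Sum.inr l => MvPolynomial.pderiv (Sum.inr (a, l)) f

/-- The operator `∑_μ (∂/∂k_b^μ) (∂/∂k_{a,μ})` in `D` dimensions, on functions of the dot products.
The first term comes from `∂k_c^μ/∂k_b^μ = D` if `b = c` (and `0` otherwise), the second one from
differentiating the coefficients of `∂f/∂k_{a,μ} = ∑_w (gradCoeff a w f) w^μ`. -/
def contraction (G : Matrix (Fin n) (Fin n) ℝ) (D : ℂ) (a b : Fin L) (f : DotPoly L n) :
    DotPoly L n :=
  MvPolynomial.C D * gradCoeff a (Sum.inl b) f +
    ∑ w : Momentum L n, ∑ w' : Momentum L n, dot G w' w * gradCoeff b w' (gradCoeff a w f)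

/-- `∑_{a,b} (A⁻¹)_{ab} ∑_μ (∂/∂k_b^μ) (∂/∂k_{a,μ})`. -/
def laplacian (G : Matrix (Fin n) (Fin n) ℝ) (D : ℂ) (A : Matrix (Fin L) (Fin L) ℝ)
    (f : DotPoly L n) : DotPoly L n :=
  ∑ a, ∑ b, MvPolynomial.C ((A⁻¹ a b : ℝ) : ℂ) * contraction G D a b f

/-- The operator `exp((i/4) ∑_{a,b} (A⁻¹)_{ab} ∂_a · ∂_b)`.  It sends `f` to the average of
`l ↦ f(k + l)` for the `D`-dimensional Gaussian weight `exp(i ∑_{a,b} A_{ab} l_a · l_b)`, whose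
second moments are `⟨l_a^μ l_b^ν⟩ = (i/2) (A⁻¹)_{ab} g^{μν}` with `g^μ_μ = D`.  The exponential
series stops at the total degree of `f`, because each step removes two loop momenta and every
variable contains at most two. -/
def gaussianAverage (G : Matrix (Fin n) (Fin n) ℝ) (D : ℂ) (A : Matrix (Fin L) (Fin L) ℝ)
    (f : DotPoly L n) : DotPoly L n :=
  ∑ r ∈ Finset.range (f.totalDegree + 1),
    MvPolynomial.C ((Complex.I / 4) ^ r / (r.factorial : ℂ)) * (laplacian G D A)^[r] f

/-- The value of `f` at `k_a = ∑_l v_{al} p_l`. -/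
def evalAt (G : Matrix (Fin n) (Fin n) ℝ) (hG : G.IsSymm) (v : Matrix (Fin L) (Fin n) ℝ)
    (f : DotPoly L n) : ℂ :=
  MvPolynomial.eval
    (Sum.elim
      (Sym2.lift ⟨fun a b => (((v * G * v.transpose) a b : ℝ) : ℂ), by
        intro a b
        have h : (v * G * v.transpose).transpose = v * G * v.transpose := by
          rw [Matrix.transpose_mul, Matrix.transpose_mul, Matrix.transpose_transpose, hG.eq,
            Matrix.mul_assoc]
        have h' : (v * G * v.transpose) b a = (v * G * v.transpose) a b := congrFun (congrFun h a) b
        exact congrArg (fun r : ℝ => (r : ℂ)) h'.symm⟩)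
      (fun al => (((v * G) al.1 al.2 : ℝ) : ℂ))) f

/-- The `D`-dimensional Gaussian integral over Minkowski loop momenta
`∫ ∏_a d^D k_a / (i π^{D/2}) · f · exp(i (∑ A_{ab} k_a · k_b + 2 ∑ B_{al} k_a · p_l + c))`
for `A` positive definite: completing the square, `k = l - A⁻¹ B p`, it is
`det(i A)^{-D/2} exp(i (c - ∑ (A⁻¹)_{ab} B_{al} B_{bl'} p_l · p_l'))` times the Gaussian average
of `f` around `k = - A⁻¹ B p`. -/
def gaussianIntegral (G : Matrix (Fin n) (Fin n) ℝ) (hG : G.IsSymm) (D : ℂ)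
    (A : Matrix (Fin L) (Fin L) ℝ) (B : Matrix (Fin L) (Fin n) ℝ) (c : ℂ) (f : DotPoly L n) : ℂ :=
  Complex.I ^ (-((L : ℂ) * D) / 2) * ((A.det : ℝ) : ℂ) ^ (-D / 2) *
    Complex.exp (Complex.I * (c - (((A⁻¹ * B * G * B.transpose).trace : ℝ) : ℂ))) *
    evalAt G hG (-(A⁻¹ * B)) (gaussianAverage G D A f)

/-! ### Feynman integrals -/

/-- The data of a family of `L`-loop Feynman integrals with `E` external momenta
(of which `E - 1` are independent, because of momentum conservation) and `p` propagators. -/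
structure Family (L E p : ℕ) where
  /-- Coefficients `α_{ja}` of the loop momenta in `q_j`. -/
  loopCoeff : Fin p → Fin L → SignType
  /-- Coefficients `β_{jl}` of the external momenta in `q_j`. -/
  extCoeff : Fin p → Fin (E - 1) → SignType
  /-- The dot products `p_l · p_l'` of the independent external momenta. -/
  gram : Matrix (Fin (E - 1)) (Fin (E - 1)) ℝ
  gram_symm : gram.IsSymm
  /-- The propagator masses `m_j`. -/
  mass : Fin p → ℝ
  /-- The dimension `D₀` around which one expands, `D = D₀ - 2 ε`. -/
  baseDim : ℕ
  /-- The numerator, a polynomial in the dot products that involve a loop momentum; its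
  coefficients are functions of the dimension `D`. -/
  numerator : MvPolynomial (DotProduct L (E - 1)) (ℂ → ℂ)

namespace Family

variable {E : ℕ} (F : Family L E p)

/-- The coefficients `α_{ja}`, `β_{jl}` of `q_j = ∑_a α_{ja} k_a + ∑_l β_{jl} p_l`, in `ℝ`. -/
def coeff (j : Fin p) : Momentum L (E - 1) → ℝ :=
  Sum.elim (fun a => ((F.loopCoeff j a : SignType) : ℝ)) (fun l => ((F.extCoeff j l : SignType) : ℝ))

/-- The squared mass with the Feynman prescription, `m_j² - i η`. -/
def massSq (η : ℝ) (j : Fin p) : ℂ := ((F.mass j ^ 2 : ℝ) : ℂ) - Complex.I * (η : ℂ)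

/-- The inverse propagator `m_j² - q_j² - i η`. -/
def inversePropagator (η : ℝ) (j : Fin p) : DotPoly L (E - 1) :=
  MvPolynomial.C (F.massSq η j) -
    ∑ w : Momentum L (E - 1), ∑ w' : Momentum L (E - 1),
      MvPolynomial.C ((F.coeff j w * F.coeff j w' : ℝ) : ℂ) * dot F.gram w w'

/-- The numerator `N` in dimension `D`, times all factors `(m_j² - q_j² - i η)^{-ν_j}` with
`ν_j < 0` (the exponent `(-ν_j).toNat` is `0` if `ν_j ≥ 0`). -/
def polynomialPart (ν : Fin p → ℤ) (η : ℝ) (D : ℂ) : DotPoly L (E - 1) :=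
  MvPolynomial.map (Pi.evalRingHom (fun _ : ℂ => ℂ) D) F.numerator *
    ∏ j, F.inversePropagator η j ^ (-ν j).toNat

/-- The regularised Feynman integral
`∫ ∏_a e^{γ ε} d^D k_a / (i π^{D/2}) · exp(i δ ∑_a k_a²) · N / ∏_j (m_j² - q_j² - i η)^{ν_j}`
with `ε = (D₀ - D)/2`, `η > 0` and a convergence factor with `δ > 0`.  Every factor with
`ν_j > 0` is written as
`(m_j² - q_j² - i η)^{-ν_j} = (i^{ν_j} / Γ(ν_j)) ∫_0^∞ α^{ν_j - 1} e^{-i α (m_j² - q_j² - i η)} dα`,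
all other factors are part of the polynomial, and the loop momenta are integrated first.  The
integral over the Schwinger parameters `α` converges absolutely, thanks to `η, δ > 0`. -/
def regularised (ν : Fin p → ℤ) (η δ : ℝ) (D : ℂ) : ℂ :=
  Complex.exp ((Real.eulerMascheroniConstant : ℂ) * (L : ℂ) * (((F.baseDim : ℂ) - D) / 2)) *
    (∏ j : {j : Fin p // 0 < ν j}, Complex.I ^ ν j / Complex.Gamma ((ν j : ℤ) : ℂ)) *
    ∫ α in {α : {j : Fin p // 0 < ν j} → ℝ | ∀ j, 0 < α j},
      (∏ j : {j : Fin p // 0 < ν j}, (α j : ℂ) ^ (ν j - 1)) *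
        gaussianIntegral F.gram F.gram_symm D
          (δ • (1 : Matrix (Fin L) (Fin L) ℝ) +
            Matrix.of fun a b => ∑ j : {j : Fin p // 0 < ν j},
              α j * F.coeff j (Sum.inl a) * F.coeff j (Sum.inl b))
          (Matrix.of fun a l => ∑ j : {j : Fin p // 0 < ν j},
            α j * F.coeff j (Sum.inl a) * F.coeff j (Sum.inr l))
          (∑ j : {j : Fin p // 0 < ν j}, (α j : ℂ) *
            (((∑ l, ∑ l', F.coeff j (Sum.inr l) * F.coeff j (Sum.inr l') * F.gram l l' : ℝ) : ℂ) -
              F.massSq η j))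
          (F.polynomialPart ν η D)

/-- `J` is the dimensionally regularised Feynman integral with propagators
`1 / (m_j² - q_j² - i η)` for a fixed `η > 0`, as a function of `D`: it is meromorphic on `ℂ`
(in normal form, i.e. removable singularities are removed, and poles carry the value `0`), and
where `Re D` is sufficiently negative, so that there are no divergences at large loop momenta,
it is the limit of the regularised integrals as the convergence factor is removed. -/
def IsDimReg (ν : Fin p → ℤ) (η : ℝ) (J : ℂ → ℂ) : Prop :=
  MeromorphicNFOn J Set.univ ∧
    ∃ R : ℝ, ∀ᶠ D in codiscrete ℂ, D.re < R →
      Tendsto (fun δ : ℝ => F.regularised ν η δ D) (𝓝[>] 0) (𝓝 (J D))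

/-- `I` is the Feynman integral `D ↦ I(x; ν; D)` in dimensional regularisation: it is meromorphic
on `ℂ` (in normal form), and it is the limit `η → 0⁺` of the integrals with propagators
`1 / (m_j² - q_j² - i η)`.  The limit is taken where `Re D` is sufficiently large, so that there
are no divergences at small loop momenta if masses vanish; elsewhere `I` is the meromorphic
continuation in `D`. -/
def IsFeynmanIntegral (ν : Fin p → ℤ) (I : ℂ → ℂ) : Prop :=
  MeromorphicNFOn I Set.univ ∧
    ∃ J : ℝ → ℂ → ℂ, (∀ η : ℝ, 0 < η → F.IsDimReg ν η (J η)) ∧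
      ∃ R : ℝ, ∀ᶠ D in codiscrete ℂ, R < D.re →
        Tendsto (fun η : ℝ => J η D) (𝓝[>] 0) (𝓝 (I D))

end Family

end FeynmanIntegral

end

/-! With no propagator in the denominator the integral has no scale. There are no Schwinger
parameters, so the regularised integral is a Gaussian integral with `A = δ • 1`, `B = 0`, `c = 0` of
a polynomial `f`. By homogeneity it is a finite sum of constants times `δ ^ (-L D / 2 - r)`, `r ≤
deg f` (`gaussianIntegral_smul_one`). For `Re D` sufficiently negative every term tends to zero as
`δ → 0⁺`.

Hence each `J η` vanishes on a left half-plane up to a discrete set, and everywhere by the identity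
theorem. The limit `η → 0⁺`, taken on a right half-plane, is then a limit of zeros, and the identity
theorem applies once more to `I`. -/

namespace MeromorphicNFOn

/-- Identity theorem: a meromorphic function in normal form that vanishes near one point, the point
itself excepted, vanishes everywhere. -/
theorem eq_zero_of_eventually_nhdsNE {f : ℂ → ℂ} (hf : MeromorphicNFOn f Set.univ) {x : ℂ}
    (hx : ∀ᶠ z in 𝓝[≠] x, f z = 0) (z : ℂ) : f z = 0 := by
  have hz : meromorphicOrderAt f z = ⊤ := by
    by_contra h
    exact hf.meromorphicOn.meromorphicOrderAt_ne_top_of_isPreconnected isPreconnected_univ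
      (Set.mem_univ z) (Set.mem_univ x) h (meromorphicOrderAt_eq_top_iff.2 hx)
  -- Order `⊤` gives vanishing only on a punctured neighbourhood of `z`. The normal form of both
  -- functions fixes the value at `z` itself.
  have h0 : MeromorphicNFAt (fun _ : ℂ => (0 : ℂ)) z := analyticAt_const.meromorphicNFAt
  exact (((hf (Set.mem_univ z)).eventuallyEq_nhdsNE_iff_eventuallyEq_nhds h0).1
    (meromorphicOrderAt_eq_top_iff.1 hz)).eq_of_nhds

/-- A meromorphic function in normal form that vanishes on a nonempty open set, up to a closed
discrete set, vanishes everywhere. -/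
theorem eq_zero_of_eventually_codiscrete {f : ℂ → ℂ} (hf : MeromorphicNFOn f Set.univ)
    {U : Set ℂ} (hU : IsOpen U) (hne : U.Nonempty)
    (h : ∀ᶠ z in codiscrete ℂ, z ∈ U → f z = 0) (z : ℂ) : f z = 0 := by
  obtain ⟨x, hx⟩ := hne
  refine hf.eq_zero_of_eventually_nhdsNE (x := x) ?_ z
  have h' : ∀ᶠ z in 𝓝[≠] x, z ∈ U → f z = 0 := by
    have := mem_codiscreteWithin_iff_forall_mem_nhdsNE.1 h x (Set.mem_univ x)
    rwa [Set.compl_univ, Set.union_empty] at this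
  filter_upwards [h', nhdsWithin_le_nhds (hU.mem_nhds hx)] with y hy hyU using hy hyU

end MeromorphicNFOn

theorem MvPolynomial.totalDegree_map_le_totalDegree {σ R S : Type*} [CommSemiring R]
    [CommSemiring S] (φ : R →+* S) (f : MvPolynomial σ R) :
    (MvPolynomial.map φ f).totalDegree ≤ f.totalDegree :=
  Finset.sup_mono (MvPolynomial.support_map_subset φ f)

/-- `δ ^ (-L D / 2 - r)` tends to zero as `δ → 0⁺` if `Re D` is sufficiently negative. -/
theorem Complex.tendsto_pow_cpow_mul_inv_pow {L r : ℕ} {D : ℂ} (hD : L * D.re < -2 * r) :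
    Tendsto (fun δ : ℝ => ((δ ^ L : ℝ) : ℂ) ^ (-D / 2) * ((δ⁻¹ : ℝ) : ℂ) ^ r)
      (𝓝[>] 0) (𝓝 0) := by
  have hs : 0 < L * (-D / 2).re - r := by
    -- For a positive base the norm of a complex power sees only the real part of the exponent.
    have : (-D / 2).re = -D.re / 2 := by simp
    rw [this]; linarith
  have ht : Tendsto (fun δ : ℝ => δ ^ (L * (-D / 2).re - r : ℝ)) (𝓝[>] 0) (𝓝 0) := by
    have := (Real.continuousAt_rpow_const 0 _ (Or.inr hs.le)).tendsto
    rw [Real.zero_rpow hs.ne'] at this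
    exact this.mono_left nhdsWithin_le_nhds
  refine tendsto_zero_iff_norm_tendsto_zero.2 (ht.congr' ?_)
  filter_upwards [self_mem_nhdsWithin] with δ hδ
  have hδ : 0 < δ := hδ
  rw [norm_mul, Complex.norm_cpow_eq_rpow_re_of_pos (pow_pos hδ L), norm_pow, Complex.norm_real,
    Real.norm_of_nonneg (inv_nonneg.2 hδ.le), inv_pow, Real.rpow_sub hδ, Real.rpow_mul hδ.le,
    Real.rpow_natCast, Real.rpow_natCast, div_eq_mul_inv]

/-! ### Scaling of the Gaussian integral in `δ` -/

namespace FeynmanIntegral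

variable {L n p E : ℕ}

theorem gradCoeff_C_mul (a : Fin L) (w : Momentum L n) (c : ℂ) (f : DotPoly L n) :
    gradCoeff a w (MvPolynomial.C c * f) = MvPolynomial.C c * gradCoeff a w f := by
  cases w
  · simp only [gradCoeff, MvPolynomial.pderiv_C_mul]
    exact mul_left_comm _ _ _
  · simp only [gradCoeff, MvPolynomial.pderiv_C_mul]

theorem contraction_C_mul (G : Matrix (Fin n) (Fin n) ℝ) (D : ℂ) (a b : Fin L) (c : ℂ)
    (f : DotPoly L n) :
    contraction G D a b (MvPolynomial.C c * f) = MvPolynomial.C c * contraction G D a b f := by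
  simp only [contraction, gradCoeff_C_mul, mul_add, Finset.mul_sum]
  exact congrArg₂ (· + ·) (mul_left_comm _ _ _)
    (Finset.sum_congr rfl fun _ _ => Finset.sum_congr rfl fun _ _ => mul_left_comm _ _ _)

theorem laplacian_C_mul (G : Matrix (Fin n) (Fin n) ℝ) (D : ℂ) (A : Matrix (Fin L) (Fin L) ℝ)
    (c : ℂ) (f : DotPoly L n) :
    laplacian G D A (MvPolynomial.C c * f) = MvPolynomial.C c * laplacian G D A f := by
  simp only [laplacian, contraction_C_mul, Finset.mul_sum]
  exact Finset.sum_congr rfl fun _ _ => Finset.sum_congr rfl fun _ _ => mul_left_comm _ _ _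

theorem laplacian_smul_one (G : Matrix (Fin n) (Fin n) ℝ) (D : ℂ) {δ : ℝ} (hδ : δ ≠ 0)
    (f : DotPoly L n) :
    laplacian G D (δ • 1) f = MvPolynomial.C ((δ⁻¹ : ℝ) : ℂ) * laplacian G D 1 f := by
  have h : (δ • (1 : Matrix (Fin L) (Fin L) ℝ))⁻¹ = δ⁻¹ • 1 := by
    refine Matrix.inv_eq_right_inv ?_
    simp [smul_smul, hδ]
  simp only [laplacian, h, Finset.mul_sum, Matrix.smul_apply, smul_eq_mul, inv_one,
    Complex.ofReal_mul, MvPolynomial.C_mul, mul_assoc]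

theorem iterate_laplacian_smul_one (G : Matrix (Fin n) (Fin n) ℝ) (D : ℂ) {δ : ℝ} (hδ : δ ≠ 0)
    (f : DotPoly L n) (r : ℕ) :
    (laplacian G D (δ • 1))^[r] f =
      MvPolynomial.C (((δ⁻¹ : ℝ) : ℂ) ^ r) * (laplacian G D 1)^[r] f := by
  induction r with
  | zero => simp
  | succ r ih =>
    rw [Function.iterate_succ_apply', Function.iterate_succ_apply', ih, laplacian_C_mul,
      laplacian_smul_one G D hδ, ← mul_assoc, ← MvPolynomial.C_mul, pow_succ]

/-- The determinant contributes `δ ^ L`, and each Laplacian contributes one factor `δ⁻¹`. Since `B =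
0`, the centre of the Gaussian is `k = 0`, so nothing else depends on `δ`. -/
theorem gaussianIntegral_smul_one (G : Matrix (Fin n) (Fin n) ℝ) (hG : G.IsSymm) (D : ℂ) {δ : ℝ}
    (hδ : δ ≠ 0) (f : DotPoly L n) :
    gaussianIntegral G hG D (δ • 1) 0 0 f =
      ∑ r ∈ Finset.range (f.totalDegree + 1),
        Complex.I ^ (-((L : ℂ) * D) / 2) * ((Complex.I / 4) ^ r / (r.factorial : ℂ)) *
          evalAt G hG 0 ((laplacian G D 1)^[r] f) *
          (((δ ^ L : ℝ) : ℂ) ^ (-D / 2) * ((δ⁻¹ : ℝ) : ℂ) ^ r) := by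
  have hdet : (δ • (1 : Matrix (Fin L) (Fin L) ℝ)).det = δ ^ L := by simp
  have h0 : -((δ • (1 : Matrix (Fin L) (Fin L) ℝ))⁻¹ * (0 : Matrix (Fin L) (Fin n) ℝ)) = 0 := by
    simp
  rw [gaussianIntegral, hdet, h0]
  simp only [gaussianAverage, iterate_laplacian_smul_one G D hδ, evalAt, map_sum, map_mul,
    MvPolynomial.eval_C, Matrix.mul_zero, Matrix.zero_mul, Matrix.trace_zero, Complex.ofReal_zero,
    sub_zero, mul_zero, Complex.exp_zero, mul_one, Finset.mul_sum]
  exact Finset.sum_congr rfl fun _ _ => by ring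

theorem tendsto_gaussianIntegral_smul_one (G : Matrix (Fin n) (Fin n) ℝ) (hG : G.IsSymm) {D : ℂ}
    (f : DotPoly L n) (hD : L * D.re < -2 * f.totalDegree) :
    Tendsto (fun δ : ℝ => gaussianIntegral G hG D (δ • 1) 0 0 f) (𝓝[>] 0) (𝓝 0) := by
  have h : Tendsto (fun δ : ℝ => ∑ r ∈ Finset.range (f.totalDegree + 1),
        Complex.I ^ (-((L : ℂ) * D) / 2) * ((Complex.I / 4) ^ r / (r.factorial : ℂ)) *
          evalAt G hG 0 ((laplacian G D 1)^[r] f) *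
          (((δ ^ L : ℝ) : ℂ) ^ (-D / 2) * ((δ⁻¹ : ℝ) : ℂ) ^ r)) (𝓝[>] 0) (𝓝 0) := by
    have h0 : ∑ _r ∈ Finset.range (f.totalDegree + 1), (0 : ℂ) = 0 := Finset.sum_const_zero
    refine h0 ▸ tendsto_finsetSum _ fun r hr => ?_
    have hr' : (r : ℝ) ≤ f.totalDegree := by
      exact_mod_cast Nat.lt_succ_iff.1 (Finset.mem_range.1 hr)
    simpa using (Complex.tendsto_pow_cpow_mul_inv_pow (L := L) (r := r) (D := D)
      (by linarith)).const_mul _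
  refine h.congr' ?_
  filter_upwards [self_mem_nhdsWithin] with δ hδ
  exact (gaussianIntegral_smul_one G hG D (ne_of_gt hδ) f).symm

/-! ### Vanishing of scaleless integrals -/

namespace Family

variable (F : Family L E p) {ν : Fin p → ℤ}

/-- The half-plane in `IsDimReg` is chosen before `D`, so the degree bound must be uniform in `D`.
Only the numerator depends on `D`, and specialising its coefficients cannot raise its degree. -/
theorem exists_totalDegree_polynomialPart_le (ν : Fin p → ℤ) (η : ℝ) :
    ∃ N : ℕ, ∀ D : ℂ, (F.polynomialPart ν η D).totalDegree ≤ N :=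
  ⟨_, fun _ => (MvPolynomial.totalDegree_mul _ _).trans
    (Nat.add_le_add_right (MvPolynomial.totalDegree_map_le_totalDegree _ _) _)⟩

/-- Without propagators in the denominator there are no Schwinger parameters. -/
theorem regularised_of_nonpos (hν : ∀ j, ν j ≤ 0) (η δ : ℝ) (D : ℂ) :
    F.regularised ν η δ D =
      Complex.exp ((Real.eulerMascheroniConstant : ℂ) * (L : ℂ) *
        (((F.baseDim : ℂ) - D) / 2)) *
        gaussianIntegral F.gram F.gram_symm D (δ • 1) 0 0 (F.polynomialPart ν η D) := by
  have : IsEmpty {j : Fin p // 0 < ν j} := ⟨fun j => (hν j.1).not_gt j.2⟩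
  have hA : (Matrix.of fun _ _ => 0 : Matrix (Fin L) (Fin L) ℝ) = 0 := rfl
  have hB : (Matrix.of fun _ _ => 0 : Matrix (Fin L) (Fin (E - 1)) ℝ) = 0 := rfl
  -- The domain of integration is a single point, the empty function, of measure one.
  simp only [regularised, Finset.univ_eq_empty, Finset.prod_empty, Finset.sum_empty, hA, hB,
    add_zero, mul_one, one_mul, IsEmpty.forall_iff, Set.ofPred_true, Measure.restrict_univ,
    integral_const, measureReal_def, volume_pi, Measure.pi_univ, ENNReal.toReal_one, one_smul]

theorem isDimReg_zero (hL : 1 ≤ L) (hν : ∀ j, ν j ≤ 0) (η : ℝ) :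
    F.IsDimReg ν η (fun _ => 0) := by
  obtain ⟨N, hN⟩ := F.exists_totalDegree_polynomialPart_le ν η
  -- As `Re D < -2 N ≤ 0` and `L ≥ 1`, also `L * Re D ≤ Re D < -2 N`.
  refine ⟨fun _ _ => analyticAt_const.meromorphicNFAt, -2 * N, .of_forall fun D hD => ?_⟩
  have hL' : (1 : ℝ) ≤ L := by exact_mod_cast hL
  have hdeg : ((F.polynomialPart ν η D).totalDegree : ℝ) ≤ N := by exact_mod_cast hN D
  have hD' : L * D.re < -2 * (F.polynomialPart ν η D).totalDegree := by
    nlinarith [Nat.cast_nonneg (α := ℝ) N]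
  simp only [F.regularised_of_nonpos hν]
  simpa using (tendsto_gaussianIntegral_smul_one F.gram F.gram_symm _ hD').const_mul _

theorem IsDimReg.unique {F : Family L E p} {η : ℝ} {J J' : ℂ → ℂ} (hJ : F.IsDimReg ν η J)
    (hJ' : F.IsDimReg ν η J') : ∃ R : ℝ, ∀ᶠ D in codiscrete ℂ, D.re < R → J D = J' D := by
  obtain ⟨-, R, hR⟩ := hJ
  obtain ⟨-, R', hR'⟩ := hJ'
  refine ⟨min R R', ?_⟩
  filter_upwards [hR, hR'] with D h h' hD
  exact tendsto_nhds_unique (h (hD.trans_le (min_le_left _ _)))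
    (h' (hD.trans_le (min_le_right _ _)))

theorem IsDimReg.eq_zero {F : Family L E p} (hL : 1 ≤ L) (hν : ∀ j, ν j ≤ 0) {η : ℝ}
    {J : ℂ → ℂ} (hJ : F.IsDimReg ν η J) (D : ℂ) : J D = 0 := by
  obtain ⟨R, hR⟩ := hJ.unique (F.isDimReg_zero hL hν η)
  exact hJ.1.eq_zero_of_eventually_codiscrete (isOpen_Iio.preimage Complex.continuous_re)
    ⟨((R - 1 : ℝ) : ℂ), by simp⟩ hR D

end Family

end FeynmanIntegral

theorem mainTheorem2 {L E p : ℕ} (hL : 1 ≤ L) (F : FeynmanIntegral.Family L E p)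
    (ν : Fin p → ℤ) (hν : ∀ j, ν j ≤ 0) :
    F.IsFeynmanIntegral ν (fun _ => 0) ∧
      ∀ I : ℂ → ℂ, F.IsFeynmanIntegral ν I → ∀ D : ℂ, I D = 0 := by
  refine ⟨⟨fun _ _ => analyticAt_const.meromorphicNFAt, fun _ _ => 0,
    fun η _ => F.isDimReg_zero hL hν η, 0, .of_forall fun _ _ => tendsto_const_nhds⟩, ?_⟩
  -- The limit in `η` concerns large `Re D`, away from where `J η` is given by a limit in `δ`. So
  -- the vanishing of `J η` at every `D` is needed.
  rintro I ⟨hI, J, hJ, R, hR⟩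
  refine hI.eq_zero_of_eventually_codiscrete (isOpen_Ioi.preimage Complex.continuous_re)
    ⟨((R + 1 : ℝ) : ℂ), by simp⟩ (U := Complex.re ⁻¹' Set.Ioi R) ?_
  filter_upwards [hR] with D h hD
  refine tendsto_nhds_unique (h hD) (tendsto_const_nhds.congr' ?_)
  filter_upwards [self_mem_nhdsWithin] with η hη
  exact ((hJ η hη).eq_zero hL hν D).symm
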